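/- Let $h:[0,\infty)\to\mathbb R$ be continuous (for instance $h=f'$ for a radial potential $f$ of class $C^1$) with $h(r)\le 0$ for all $r>0$, and consider, in dimension $n=4$, the radial equation $$u''(r)+\frac{n-1}{r}u'(r)-(n-2)u(r)^3-\frac{2(n-1)}{r}u(r)^2-\frac{n-1}{r^2}u(r)+(n-4)u(r)u'(r)=\Big[u'(r)+\frac{u(r)}{r}\Big]h(r),\qquad r>0, \tag{1}$$ that is, $u''+\frac3r u'-2u^3-\frac6r u^2-\frac3{r^2}u=\big[u'+\frac ur\big]h$. A solution of (1) on an interval $[0,R)$, $0<R\le\infty$, is a function $u\in C^2[0,R)$ that satisfies (1) for all $0<r<R$; it is global if $R=\infty$, and negative if $u(r)<0$ for all $0<r<R$. Then for every $\alpha<0$ the solution of (1) with $u(0)=0$, $u'(0)=\alpha$ is global and satisfies $$-\frac2r<u(r)<0\qquad\text{for all } r>0.$$ Here "the solution" means that there is a global solution $u$ with these initial data, and that every solution on some $[0,R)$, $0<R\le\infty$, with the same initial data coincides with $u$ on $[0,R)$. In particular, (1) has infinitely many negative global solutions (distinct as functions on $[0,\infty)$). -/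

import Mathlib

/-- `u` solves, at the point `r`, the radial equation in dimension `n`
`u'' + (n-1)/r u' - (n-2) u³ - 2(n-1)/r u² - (n-1)/r² u + (n-4) u u' = (u' + u/r) h`. -/
def RadialODEAt (n : ℕ) (h u : ℝ → ℝ) (r : ℝ) : Prop :=
  deriv (deriv u) r + ((n : ℝ) - 1) / r * deriv u r - ((n : ℝ) - 2) * u r ^ 3
      - 2 * ((n : ℝ) - 1) / r * u r ^ 2 - ((n : ℝ) - 1) / r ^ 2 * u r
      + ((n : ℝ) - 4) * u r * deriv u r
    = (deriv u r + u r / r) * h r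

/-- `u` is a solution of the radial equation on `s`, where `s` is an interval `[0, R)` or `[0, ∞)`:
it is `C²` on `s` (one-sidedly at `0`) and satisfies the equation at every `r > 0` of `s`.
Such points are interior to `s`, so the ordinary derivatives there are the genuine ones.
The values of `u` outside `s` play no role. -/
def IsRadialSolution (n : ℕ) (h : ℝ → ℝ) (s : Set ℝ) (u : ℝ → ℝ) : Prop :=
  ContDiffOn ℝ 2 u s ∧ ∀ r ∈ s, 0 < r → RadialODEAt n h u r

/-- The initial conditions `u(0) = 0`, `u'(0) = α` (right derivative at `0`). -/
def HasInitialData (α : ℝ) (u : ℝ → ℝ) : Prop :=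
  u 0 = 0 ∧ HasDerivWithinAt u α (Set.Ici 0) 0

/-!
Put `y = u / r`, `w = r u = r² y` and `t = log r`. For `n = 4` the equation becomes
`ẅ = 2 w (w + 1) (w + 2) + r h ẇ`, so, as `h ≤ 0`, the energy `ẇ² - (w² + 2 w)²` is nonincreasing;
it starts at `0`, hence `|ẇ| ≤ -w (w + 2)` as long as `-2 < w < 0`. In terms of `y` this says that
`y` and `1 / y + r² / 2` are respectively nondecreasing and nonincreasing, and so is `r⁴ y`; the
last two keep `w` away from `-2` and `0`.

Existence: `y` solves `r y'' + 5 y' = F (r, y, r y')`, which is regular singular at `0` and has a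
global solution once `y` is truncated in `F`; the confinement shows that the truncation is never
active. Uniqueness: `A = u' + 3 u / r` and `B = u' - u / r` satisfy `A' = F` and `B' = F - 4 B / r`,
whose singular term has the good sign in a Grönwall estimate for `A² + B²`.
-/

open Set Filter Topology

section SingularVolterra

theorem exists_continuous_fixedPoint_of_weighted_contraction {S E : Type*} [TopologicalSpace S]
    [NormedAddCommGroup E] [NormedSpace ℝ E] [CompleteSpace E] {V : (S → E) → S → E} {φ : S → ℝ}
    {q : NNReal} {C : ℝ} (hq : q < 1) (hφ : Continuous φ) (hφ_pos : ∀ s, 0 < φ s)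
    (hV : ∀ X, Continuous X → Continuous (V X)) (hV_zero : ∀ s, ‖V 0 s‖ ≤ φ s * C)
    (hV_contract : ∀ X Y N, Continuous X → Continuous Y → 0 ≤ N →
      (∀ s, ‖X s - Y s‖ ≤ φ s * N) → ∀ s, ‖V X s - V Y s‖ ≤ φ s * (q * N)) :
    ∃ X, Continuous X ∧ V X = X := by
  have norm_inv_smul_le {s : S} {x : E} {N : ℝ} (hx : ‖x‖ ≤ φ s * N) : ‖(φ s)⁻¹ • x‖ ≤ N := by
    rwa [norm_smul, Real.norm_of_nonneg (inv_pos.2 (hφ_pos s)).le, inv_mul_le_iff₀ (hφ_pos s)]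
  have norm_smul_le {s : S} {x : E} {N : ℝ} (hx : ‖x‖ ≤ N) : ‖φ s • x‖ ≤ φ s * N := by
    rw [norm_smul, Real.norm_of_nonneg (hφ_pos s).le]
    exact mul_le_mul_of_nonneg_left hx (hφ_pos s).le
  have hV_bound (A : BoundedContinuousFunction S E) (s : S) :
      ‖V (fun s => φ s • A s) s‖ ≤ φ s * (q * ‖A‖ + C) := by
    have hdiff := hV_contract (fun s => φ s • A s) 0 ‖A‖ (hφ.smul A.continuous) continuous_zero
      (norm_nonneg A) (fun s => by simpa using norm_smul_le (A.norm_coe_le_norm s)) s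
    rw [mul_add]
    exact (norm_le_norm_sub_add _ _).trans (add_le_add hdiff (hV_zero s))
  -- Conjugating by the weight turns the weighted sup norm into the usual one.
  let T (A : BoundedContinuousFunction S E) : BoundedContinuousFunction S E :=
    .ofNormedAddCommGroup (fun s => (φ s)⁻¹ • V (fun s => φ s • A s) s)
      ((hφ.inv₀ fun s => (hφ_pos s).ne').smul (hV _ (hφ.smul A.continuous)))
      (q * ‖A‖ + C) fun s => norm_inv_smul_le (hV_bound A s)
  have hT : ContractingWith q T := by
    refine ⟨hq, LipschitzWith.of_dist_le_mul fun A B => ?_⟩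
    rw [BoundedContinuousFunction.dist_le (by positivity)]
    intro s
    have hAB (s : S) : ‖φ s • A s - φ s • B s‖ ≤ φ s * dist A B := by
      rw [← smul_sub]
      exact norm_smul_le (dist_eq_norm (A s) (B s) ▸ A.dist_coe_le_dist s)
    have hcontract := norm_inv_smul_le <| hV_contract _ _ _ (hφ.smul A.continuous)
      (hφ.smul B.continuous) dist_nonneg hAB s
    rwa [smul_sub, ← dist_eq_norm] at hcontract
  obtain ⟨A, hA⟩ : ∃ A, T A = A := ⟨_, hT.fixedPoint_isFixedPt⟩
  refine ⟨fun s => φ s • A s, hφ.smul A.continuous, funext fun s => ?_⟩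
  have hA_s : (φ s)⁻¹ • V (fun s => φ s • A s) s = A s := DFunLike.congr_fun hA s
  rw [← hA_s, smul_inv_smul₀ (hφ_pos s).ne']

theorem integral_mul_exp_two_mul_integral {ℓ : ℝ → ℝ} (hℓ : Continuous ℓ) (x : ℝ) :
    ∫ s in (0 : ℝ)..x, ℓ s * Real.exp (2 * ∫ t in (0 : ℝ)..s, ℓ t) =
      (Real.exp (2 * ∫ t in (0 : ℝ)..x, ℓ t) - 1) / 2 := by
  have hderiv : ∀ s, HasDerivAt (fun s => Real.exp (2 * ∫ t in (0 : ℝ)..s, ℓ t) / 2)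
      (ℓ s * Real.exp (2 * ∫ t in (0 : ℝ)..s, ℓ t)) s := fun s =>
    (((hℓ.integral_hasStrictDerivAt 0 s).hasDerivAt.const_mul 2).exp.div_const 2).congr_deriv
      (by ring)
  rw [intervalIntegral.integral_eq_sub_of_hasDerivAt (fun s _ => hderiv s)
    (Continuous.intervalIntegrable (by fun_prop) _ _)]
  simp only [intervalIntegral.integral_same, mul_zero, Real.exp_zero]
  ring

/-- The Bielecki weight `exp (2 ∫₀^|r| ℓ)`. A Volterra operator whose integrand has Lipschitz
constant `ℓ` contracts by the factor `1 / 2` the sup norm weighted by its inverse. -/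
noncomputable def bieleckiWeight (ℓ : ℝ → ℝ) (r : ℝ) : ℝ :=
  Real.exp (2 * ∫ t in (0 : ℝ)..|r|, ℓ t)

theorem bieleckiWeight_pos (ℓ : ℝ → ℝ) (r : ℝ) : 0 < bieleckiWeight ℓ r :=
  Real.exp_pos _

theorem one_le_bieleckiWeight {ℓ : ℝ → ℝ} (hℓ : ∀ t, 0 ≤ ℓ |t|) (r : ℝ) :
    1 ≤ bieleckiWeight ℓ r := by
  have hint : 0 ≤ ∫ t in (0 : ℝ)..|r|, ℓ t :=
    intervalIntegral.integral_nonneg (abs_nonneg r) fun t ht => abs_of_nonneg ht.1 ▸ hℓ t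
  exact Real.one_le_exp (by positivity)

theorem continuous_bieleckiWeight {ℓ : ℝ → ℝ} (hℓ : Continuous ℓ) :
    Continuous (bieleckiWeight ℓ) := by
  have hprim : Continuous fun s => ∫ t in (0 : ℝ)..s, ℓ t :=
    intervalIntegral.continuous_primitive (fun a b => hℓ.intervalIntegrable a b) 0
  exact Real.continuous_exp.comp (continuous_const.mul (hprim.comp continuous_abs))

variable {E : Type*} [NormedAddCommGroup E] [NormedSpace ℝ E]

theorem norm_smul_integral_le_bieleckiWeight {ℓ : ℝ → ℝ} (hℓ : Continuous ℓ) {f : ℝ → E}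
    {r N : ℝ} (hN : 0 ≤ N)
    (hf : ∀ σ ∈ Icc (0 : ℝ) 1, ‖f σ‖ ≤ ℓ |r * σ| * (bieleckiWeight ℓ (r * σ) * N)) :
    ‖r • ∫ σ in (0 : ℝ)..1, f σ‖ ≤ bieleckiWeight ℓ r * (N / 2) := by
  set φ : ℝ → ℝ := fun s => ℓ s * Real.exp (2 * ∫ t in (0 : ℝ)..s, ℓ t) with hφ
  have hφ_cont : Continuous φ := by fun_prop
  have hbound : ∀ σ ∈ Ioc (0 : ℝ) 1, ‖f σ‖ ≤ φ (|r| * σ) * N := fun σ hσ => by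
    have habs : |r * σ| = |r| * σ := by rw [abs_mul, abs_of_pos hσ.1]
    simpa only [bieleckiWeight, habs, hφ, mul_assoc] using hf σ (Ioc_subset_Icc_self hσ)
  calc ‖r • ∫ σ in (0 : ℝ)..1, f σ‖
      = |r| * ‖∫ σ in (0 : ℝ)..1, f σ‖ := by rw [norm_smul, Real.norm_eq_abs]
    _ ≤ |r| * ∫ σ in (0 : ℝ)..1, φ (|r| * σ) * N :=
        mul_le_mul_of_nonneg_left (intervalIntegral.norm_integral_le_of_norm_le zero_le_one
          (.of_forall hbound) (Continuous.intervalIntegrable (by fun_prop) _ _)) (abs_nonneg r)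
    _ = (∫ s in (0 : ℝ)..|r|, φ s) * N := by
        rw [intervalIntegral.integral_mul_const, ← mul_assoc,
          intervalIntegral.mul_integral_comp_mul_left, mul_zero, mul_one]
    _ = (bieleckiWeight ℓ r - 1) / 2 * N := by
        rw [integral_mul_exp_two_mul_integral hℓ, bieleckiWeight]
    _ ≤ bieleckiWeight ℓ r * (N / 2) := by linarith

/-- The Volterra operator `X ↦ x₀ + ∫₀^r K (s / r, s, X s) ds`, rescaled to the unit interval by
`s = r σ` so that it makes sense at `r = 0`, where the kernel `s / r` is singular. -/
noncomputable def volterraMap (K : ℝ → ℝ → E → E) (x₀ : E) (X : ℝ → E) (r : ℝ) : E :=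
  x₀ + r • ∫ σ in (0 : ℝ)..1, K σ (r * σ) (X (r * σ))

variable {K : ℝ → ℝ → E → E} {ℓ : ℝ → ℝ} {X Y : ℝ → E} {N : ℝ}

theorem continuous_volterraMap (hK : Continuous fun p : ℝ × ℝ × E => K p.1 p.2.1 p.2.2) (x₀ : E)
    (hX : Continuous X) : Continuous (volterraMap K x₀ X) := by
  have hint : Continuous fun p : ℝ × ℝ => K p.2 (p.1 * p.2) (X (p.1 * p.2)) :=
    hK.comp (by fun_prop : Continuous fun p : ℝ × ℝ => (p.2, p.1 * p.2, X (p.1 * p.2)))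
  exact continuous_const.add (continuous_id.smul
    (intervalIntegral.continuous_parametric_intervalIntegral_of_continuous' hint 0 1))

theorem norm_volterraMap_sub_le (hK : Continuous fun p : ℝ × ℝ × E => K p.1 p.2.1 p.2.2)
    (hℓ : Continuous ℓ) (hℓ_nonneg : ∀ t, 0 ≤ ℓ |t|)
    (hK_lip : ∀ σ ∈ Icc (0 : ℝ) 1, ∀ s x y, ‖K σ s x - K σ s y‖ ≤ ℓ |s| * ‖x - y‖) (x₀ : E)
    (hX : Continuous X) (hY : Continuous Y) (hN : 0 ≤ N)
    (hXY : ∀ s, ‖X s - Y s‖ ≤ bieleckiWeight ℓ s * N) (r : ℝ) :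
    ‖volterraMap K x₀ X r - volterraMap K x₀ Y r‖ ≤ bieleckiWeight ℓ r * (N / 2) := by
  have hint : ∀ {Z : ℝ → E}, Continuous Z →
      IntervalIntegrable (fun σ => K σ (r * σ) (Z (r * σ))) MeasureTheory.volume 0 1 := fun hZ =>
    (hK.comp (by fun_prop : Continuous fun σ : ℝ => (σ, r * σ, _))).intervalIntegrable _ _
  rw [volterraMap, volterraMap, add_sub_add_left_eq_sub, ← smul_sub,
    ← intervalIntegral.integral_sub (hint hX) (hint hY)]
  exact norm_smul_integral_le_bieleckiWeight hℓ hN fun σ hσ =>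
    (hK_lip σ hσ _ _ _).trans (mul_le_mul_of_nonneg_left (hXY _) (hℓ_nonneg _))

theorem norm_volterraMap_zero_le (hℓ : Continuous ℓ)
    (hK_zero : ∀ σ ∈ Icc (0 : ℝ) 1, ∀ s, ‖K σ s 0‖ ≤ ℓ |s|) (x₀ : E) (r : ℝ) :
    ‖volterraMap K x₀ 0 r‖ ≤ bieleckiWeight ℓ r * (‖x₀‖ + 1 / 2) := by
  have hℓ_nonneg : ∀ t, 0 ≤ ℓ |t| := fun t =>
    (norm_nonneg _).trans (hK_zero 0 ⟨le_rfl, zero_le_one⟩ t)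
  have hbound : ∀ σ ∈ Icc (0 : ℝ) 1,
      ‖K σ (r * σ) 0‖ ≤ ℓ |r * σ| * (bieleckiWeight ℓ (r * σ) * 1) := fun σ hσ => by
    rw [mul_one]
    exact (hK_zero σ hσ _).trans
      (le_mul_of_one_le_right (hℓ_nonneg _) (one_le_bieleckiWeight hℓ_nonneg _))
  calc ‖volterraMap K x₀ 0 r‖ ≤ ‖x₀‖ + bieleckiWeight ℓ r * (1 / 2) :=
        (norm_add_le _ _).trans (add_le_add_right
          (norm_smul_integral_le_bieleckiWeight hℓ zero_le_one hbound) _)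
    _ ≤ bieleckiWeight ℓ r * (‖x₀‖ + 1 / 2) := by
        rw [mul_add]
        gcongr
        exact le_mul_of_one_le_left (norm_nonneg _) (one_le_bieleckiWeight hℓ_nonneg _)

theorem exists_continuous_eq_volterraMap [CompleteSpace E]
    (hK : Continuous fun p : ℝ × ℝ × E => K p.1 p.2.1 p.2.2) (hℓ : Continuous ℓ)
    (hK_zero : ∀ σ ∈ Icc (0 : ℝ) 1, ∀ s, ‖K σ s 0‖ ≤ ℓ |s|)
    (hK_lip : ∀ σ ∈ Icc (0 : ℝ) 1, ∀ s x y, ‖K σ s x - K σ s y‖ ≤ ℓ |s| * ‖x - y‖) (x₀ : E) :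
    ∃ X : ℝ → E, Continuous X ∧ volterraMap K x₀ X = X := by
  have hℓ_nonneg : ∀ t, 0 ≤ ℓ |t| := fun t =>
    (norm_nonneg _).trans (hK_zero 0 ⟨le_rfl, zero_le_one⟩ t)
  refine exists_continuous_fixedPoint_of_weighted_contraction (q := 1 / 2)
    (by rw [← NNReal.coe_lt_coe]; norm_num) (continuous_bieleckiWeight hℓ) (bieleckiWeight_pos ℓ)
    (fun X => continuous_volterraMap hK x₀) (norm_volterraMap_zero_le hℓ hK_zero x₀)
    fun X Y N hX hY hN hXY r => ?_
  refine (norm_volterraMap_sub_le hK hℓ hℓ_nonneg hK_lip x₀ hX hY hN hXY r).trans_eq ?_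
  push_cast
  ring

end SingularVolterra

section RegularSingularODE

/-- The scaled moment `∫₀¹ σ ^ k f (r σ) dσ`, that is, `r⁻¹ ∫₀^r (s / r) ^ k f s ds` extended to
`r = 0`. It is the solution `c` of `(r c)' = f - k c` that is regular at `0`. -/
noncomputable def scaledMoment (f : ℝ → ℝ) (k : ℕ) (r : ℝ) : ℝ :=
  ∫ σ in (0 : ℝ)..1, σ ^ k * f (r * σ)

theorem continuous_scaledMoment {f : ℝ → ℝ} (hf : Continuous f) (k : ℕ) :
    Continuous (scaledMoment f k) :=
  intervalIntegral.continuous_parametric_intervalIntegral_of_continuous' (by fun_prop) 0 1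

theorem pow_succ_mul_scaledMoment (f : ℝ → ℝ) (k : ℕ) (r : ℝ) :
    r ^ (k + 1) * scaledMoment f k r = ∫ s in (0 : ℝ)..r, s ^ k * f s := by
  have hscale := intervalIntegral.mul_integral_comp_mul_left (a := 0) (b := 1)
    (f := fun s => s ^ k * f s) r
  simp only [mul_zero, mul_one, mul_pow, mul_assoc, intervalIntegral.integral_const_mul] at hscale
  rw [← hscale, scaledMoment, pow_succ', mul_assoc]

theorem scaledMoment_zero_right (f : ℝ → ℝ) (k : ℕ) : scaledMoment f k 0 = f 0 / (k + 1) := by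
  simp only [scaledMoment, zero_mul, intervalIntegral.integral_mul_const, integral_pow]
  simp [div_eq_inv_mul]

theorem hasDerivAt_mul_scaledMoment {f : ℝ → ℝ} (hf : Continuous f) (k : ℕ) (r : ℝ) :
    HasDerivAt (fun r => r * scaledMoment f k r) (f r - k * scaledMoment f k r) r := by
  rcases eq_or_ne r 0 with rfl | hr
  · have hzero : f 0 - k * scaledMoment f k 0 = scaledMoment f k 0 := by
      rw [scaledMoment_zero_right]
      field_simp
      ring
    rw [hzero, hasDerivAt_iff_tendsto_slope]
    refine ((continuous_scaledMoment hf k).tendsto 0 |>.mono_left nhdsWithin_le_nhds).congr' ?_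
    filter_upwards [self_mem_nhdsWithin] with x (hx : x ≠ 0)
    simp [slope_def_field, hx]
  · have hderiv : HasDerivAt (fun x => x ^ (k + 1) * scaledMoment f k x) (r ^ k * f r) r := by
      rw [funext (pow_succ_mul_scaledMoment f k)]
      exact (((continuous_pow k).mul hf).integral_hasStrictDerivAt 0 r).hasDerivAt
    have hdiv := hderiv.fun_div (hasDerivAt_pow k r) (pow_ne_zero k hr)
    refine (hdiv.congr_deriv ?_).congr_of_eventuallyEq ?_
    · rcases k with _ | k
      · simp
      · rw [Nat.add_sub_cancel]
        field_simp
        ring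
    · filter_upwards [isOpen_ne.mem_nhds hr] with x (hx : x ≠ 0)
      field_simp
      ring

theorem smul_integral_smul_prodMk_pow {f : ℝ → ℝ} (hf : Continuous f) (k : ℕ) (r : ℝ) :
    r • ∫ σ in (0 : ℝ)..1, f (r * σ) • ((1 - σ ^ k) / (k : ℝ), σ ^ k) =
      ((r * scaledMoment f 0 r - r * scaledMoment f k r) / k, r * scaledMoment f k r) := by
  have hint {g : ℝ → ℝ} (hg : Continuous g) : IntervalIntegrable g MeasureTheory.volume 0 1 :=
    hg.intervalIntegrable 0 1
  have hsub : ∫ σ in (0 : ℝ)..1, f (r * σ) * ((1 - σ ^ k) / k) =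
      (scaledMoment f 0 r - scaledMoment f k r) / k := by
    rw [scaledMoment, scaledMoment, ← intervalIntegral.integral_sub (hint (by fun_prop))
      (hint (by fun_prop)), ← intervalIntegral.integral_div]
    exact intervalIntegral.integral_congr fun σ _ => by ring
  have hpair : ∫ σ in (0 : ℝ)..1, f (r * σ) • ((1 - σ ^ k) / (k : ℝ), σ ^ k) =
      (∫ σ in (0 : ℝ)..1, f (r * σ) * ((1 - σ ^ k) / k),
        ∫ σ in (0 : ℝ)..1, f (r * σ) * σ ^ k) := by
    simp only [intervalIntegral.integral_of_le zero_le_one, Prod.smul_mk, smul_eq_mul]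
    exact integral_pair (hint (by fun_prop)).1 (hint (by fun_prop)).1
  rw [hpair, hsub]
  simp only [scaledMoment, Prod.smul_mk, smul_eq_mul, mul_comm (f _)]
  ring_nf

/-- `y` is a solution of class `C¹`, with derivative `c`, of the equation
`r y'' + (k + 1) y' = F (r, y, r y')` with a regular singular point at `0`, and `y 0 = α`.
The equation is written for the derivative of `r y'`, which exists at `r = 0` too, although `y''`
need not. -/
structure IsRegularSingularSolution (k : ℕ) (F : ℝ → ℝ × ℝ → ℝ) (α : ℝ) (y c : ℝ → ℝ) :
    Prop where
  map_zero : y 0 = α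
  continuous_deriv : Continuous c
  hasDerivAt : ∀ r, HasDerivAt y (c r) r
  hasDerivAt_mul : ∀ r, HasDerivAt (fun r => r * c r) (F r (y r, r * c r) - k * c r) r

theorem norm_one_sub_pow_div_prodMk_pow_le_one {k : ℕ} (hk : k ≠ 0) {σ : ℝ}
    (hσ : σ ∈ Icc (0 : ℝ) 1) : ‖((1 - σ ^ k) / k, σ ^ k)‖ ≤ 1 := by
  have hk_one : (1 : ℝ) ≤ k := Nat.one_le_cast.2 (Nat.one_le_iff_ne_zero.2 hk)
  have hpow_nonneg : 0 ≤ σ ^ k := pow_nonneg hσ.1 k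
  have hpow_le : σ ^ k ≤ 1 := pow_le_one₀ hσ.1 hσ.2
  refine norm_prod_le_iff.2 ⟨?_, ?_⟩
  · rw [Real.norm_of_nonneg (by have := sub_nonneg.2 hpow_le; positivity)]
    exact div_le_one_of_le₀ (by linarith) (by positivity)
  · rwa [Real.norm_of_nonneg hpow_nonneg]

theorem exists_isRegularSingularSolution {k : ℕ} (hk : k ≠ 0) {F : ℝ → ℝ × ℝ → ℝ} {ℓ : ℝ → ℝ}
    (hF : Continuous fun p : ℝ × ℝ × ℝ => F p.1 p.2) (hℓ : Continuous ℓ)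
    (hF_zero : ∀ s, |F s 0| ≤ ℓ |s|)
    (hF_lip : ∀ s x₁ x₂, |F s x₁ - F s x₂| ≤ ℓ |s| * ‖x₁ - x₂‖) (α : ℝ) :
    ∃ y c, IsRegularSingularSolution k F α y c := by
  have hk' : (k : ℝ) ≠ 0 := Nat.cast_ne_zero.2 hk
  have hnorm_smul_le {σ : ℝ} (hσ : σ ∈ Icc (0 : ℝ) 1) (a : ℝ) :
      ‖a • ((1 - σ ^ k) / k, σ ^ k)‖ ≤ |a| := by
    rw [norm_smul, Real.norm_eq_abs]
    exact mul_le_of_le_one_right (abs_nonneg a) (norm_one_sub_pow_div_prodMk_pow_le_one hk hσ)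
  -- Variation of constants: `r y'` and `y` are the integrals of the forcing against
  -- `(s / r) ^ k` and `(1 - (s / r) ^ k) / k`.
  obtain ⟨X, hX, hXV⟩ := exists_continuous_eq_volterraMap
    (K := fun σ s x => F s x • ((1 - σ ^ k) / (k : ℝ), σ ^ k)) (by fun_prop) hℓ
    (fun σ hσ s => (hnorm_smul_le hσ _).trans (hF_zero s))
    (fun σ hσ s x₁ x₂ => by
      rw [← sub_smul]
      exact (hnorm_smul_le hσ _).trans (hF_lip s x₁ x₂)) (α, 0)
  set f : ℝ → ℝ := fun s => F s (X s)
  have hf : Continuous f := hF.comp (continuous_id.prodMk hX)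
  have hX_eq (r : ℝ) : X r =
      (α + (r * scaledMoment f 0 r - r * scaledMoment f k r) / k, r * scaledMoment f k r) := by
    rw [← congrFun hXV r, volterraMap, smul_integral_smul_prodMk_pow hf, Prod.mk_add_mk, zero_add]
  refine ⟨fun r => (X r).1, scaledMoment f k, by simp [hX_eq], continuous_scaledMoment hf k,
    fun r => ?_, fun r => ?_⟩
  · simp only [hX_eq]
    refine ((((hasDerivAt_mul_scaledMoment hf 0 r).fun_sub
      (hasDerivAt_mul_scaledMoment hf k r)).div_const k).const_add α).congr_deriv ?_
    field_simp
    simp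
  · have hX_snd : (X r).2 = r * scaledMoment f k r := congrArg Prod.snd (hX_eq r)
    rw [← hX_snd]
    exact hasDerivAt_mul_scaledMoment hf k r

end RegularSingularODE

section RadialForcing

variable {h : ℝ → ℝ}

/-- The nonlinearity of the radial equation in dimension four in terms of `y = u / r` and
`b = u' - u / r`, given as a pair `x = (y, b)`: the equation reads
`u'' + 3 (u' - u / r) / r = radialForcing h r (y, b)`. Since `b = r y'`, it is the equation
`r y'' + 5 y' = radialForcing h r (y, r y')` for `y`. -/
def radialForcing (h : ℝ → ℝ) (r : ℝ) (x : ℝ × ℝ) : ℝ :=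
  h r * (2 * x.1 + x.2) + 6 * r * x.1 ^ 2 + 2 * r ^ 3 * x.1 ^ 3

theorem radialODEAt_four_iff {u : ℝ → ℝ} {r : ℝ} (hr : r ≠ 0) :
    RadialODEAt 4 h u r ↔ deriv (deriv u) r =
      radialForcing h r (u r / r, deriv u r - u r / r) - 3 * (deriv u r - u r / r) / r := by
  have hdiff : radialForcing h r (u r / r, deriv u r - u r / r) -
      3 * (deriv u r - u r / r) / r = (deriv u r + u r / r) * h r - 3 / r * deriv u r +
        2 * u r ^ 3 + 6 / r * u r ^ 2 + 3 / r ^ 2 * u r := by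
    rw [radialForcing]
    field_simp
    ring
  rw [hdiff, RadialODEAt]
  constructor <;> intro hode <;> push_cast at * <;> linear_combination hode

theorem abs_sq_sub_sq_le {x y M : ℝ} (hx : |x| ≤ M) (hy : |y| ≤ M) :
    |x ^ 2 - y ^ 2| ≤ 2 * M * |x - y| := by
  rw [sq_sub_sq, abs_mul]
  exact mul_le_mul_of_nonneg_right ((abs_add_le _ _).trans (by linarith)) (abs_nonneg _)

theorem abs_cube_sub_cube_le {x y M : ℝ} (hx : |x| ≤ M) (hy : |y| ≤ M) :
    |x ^ 3 - y ^ 3| ≤ 3 * M ^ 2 * |x - y| := by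
  have hM : 0 ≤ M := (abs_nonneg x).trans hx
  calc |x ^ 3 - y ^ 3| = |x ^ 2 + x * y + y ^ 2| * |x - y| := by rw [← abs_mul]; ring_nf
    _ ≤ (|x| ^ 2 + |x| * |y| + |y| ^ 2) * |x - y| := by
        refine mul_le_mul_of_nonneg_right ?_ (abs_nonneg _)
        rw [← abs_pow, ← abs_mul, ← abs_pow]
        exact abs_add_three _ _ _
    _ ≤ (M ^ 2 + M * M + M ^ 2) * |x - y| := by gcongr
    _ = 3 * M ^ 2 * |x - y| := by ring

theorem abs_radialForcing_sub_le {x₁ x₂ : ℝ × ℝ} {M : ℝ} (hx₁ : |x₁.1| ≤ M) (hx₂ : |x₂.1| ≤ M)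
    (h : ℝ → ℝ) (r : ℝ) :
    |radialForcing h r x₁ - radialForcing h r x₂| ≤
      (3 * |h r| + 12 * M * |r| + 6 * M ^ 2 * |r| ^ 3) * ‖x₁ - x₂‖ := by
  have hM : 0 ≤ M := (abs_nonneg _).trans hx₁
  have hfst : |x₁.1 - x₂.1| ≤ ‖x₁ - x₂‖ := norm_fst_le (x₁ - x₂)
  have hsnd : |x₁.2 - x₂.2| ≤ ‖x₁ - x₂‖ := norm_snd_le (x₁ - x₂)
  have hlin : |2 * (x₁.1 - x₂.1) + (x₁.2 - x₂.2)| ≤ 3 * ‖x₁ - x₂‖ := by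
    refine (abs_add_le _ _).trans ?_
    rw [abs_mul, abs_two]
    linarith
  calc |radialForcing h r x₁ - radialForcing h r x₂|
      = |h r * (2 * (x₁.1 - x₂.1) + (x₁.2 - x₂.2)) + 6 * r * (x₁.1 ^ 2 - x₂.1 ^ 2) +
          2 * r ^ 3 * (x₁.1 ^ 3 - x₂.1 ^ 3)| := by rw [radialForcing, radialForcing]; ring_nf
    _ ≤ |h r| * |2 * (x₁.1 - x₂.1) + (x₁.2 - x₂.2)| + 6 * |r| * |x₁.1 ^ 2 - x₂.1 ^ 2| +
          2 * |r| ^ 3 * |x₁.1 ^ 3 - x₂.1 ^ 3| := by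
        refine (abs_add_three _ _ _).trans_eq ?_
        simp only [abs_mul, abs_pow, Nat.abs_ofNat]
    _ ≤ |h r| * (3 * ‖x₁ - x₂‖) + 6 * |r| * (2 * M * ‖x₁ - x₂‖) +
          2 * |r| ^ 3 * (3 * M ^ 2 * ‖x₁ - x₂‖) := by
        gcongr
        · exact (abs_sq_sub_sq_le hx₁ hx₂).trans (by gcongr)
        · exact (abs_cube_sub_cube_le hx₁ hx₂).trans (by gcongr)
    _ = (3 * |h r| + 12 * M * |r| + 6 * M ^ 2 * |r| ^ 3) * ‖x₁ - x₂‖ := by ring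

/-- The radial forcing with `h` replaced by its even extension and `y` truncated to `[m, 0]`. It is
globally Lipschitz in `x`, and the truncation is invisible to solutions with `m ≤ y ≤ 0`. -/
noncomputable def truncatedRadialForcing (h : ℝ → ℝ) {m : ℝ} (hm : m ≤ 0) (r : ℝ) (x : ℝ × ℝ) :
    ℝ :=
  radialForcing (fun s => h |s|) r (projIcc m 0 hm x.1, x.2)

variable {m : ℝ} (hm : m ≤ 0)

theorem truncatedRadialForcing_of_mem {r : ℝ} (hr : 0 ≤ r) {x : ℝ × ℝ} (hx : x.1 ∈ Icc m 0) :
    truncatedRadialForcing h hm r x = radialForcing h r x := by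
  rw [truncatedRadialForcing, projIcc_of_mem hm hx, radialForcing, radialForcing, abs_of_nonneg hr]

theorem continuous_truncatedRadialForcing (hh : ContinuousOn h (Ici 0)) :
    Continuous fun p : ℝ × ℝ × ℝ => truncatedRadialForcing h hm p.1 p.2 := by
  have hh_abs : Continuous fun s => h |s| := hh.comp_continuous continuous_abs abs_nonneg
  have : Continuous fun p : ℝ × ℝ × ℝ => (projIcc m 0 hm p.2.1 : ℝ) :=
    continuous_subtype_val.comp (continuous_projIcc.comp (by fun_prop))
  have hh_fst : Continuous fun p : ℝ × ℝ × ℝ => h |p.1| := hh_abs.comp continuous_fst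
  exact ((hh_fst.mul (by fun_prop)).add (by fun_prop)).add (by fun_prop)

theorem abs_truncatedRadialForcing_sub_le (s : ℝ) (x₁ x₂ : ℝ × ℝ) :
    |truncatedRadialForcing h hm s x₁ - truncatedRadialForcing h hm s x₂| ≤
      (3 * |h (|s|)| + 12 * |m| * |s| + 6 * |m| ^ 2 * |s| ^ 3) * ‖x₁ - x₂‖ := by
  have habs_projIcc_le (y : ℝ) : |(projIcc m 0 hm y : ℝ)| ≤ |m| := by
    obtain ⟨hge, hle⟩ := (projIcc m 0 hm y).2
    rw [abs_of_nonpos hle, abs_of_nonpos hm]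
    exact neg_le_neg hge
  refine (abs_radialForcing_sub_le (habs_projIcc_le x₁.1) (habs_projIcc_le x₂.1) _ s).trans ?_
  gcongr
  exact max_le_max (abs_projIcc_sub_projIcc hm) le_rfl

theorem exists_isRegularSingularSolution_truncatedRadialForcing (hh : ContinuousOn h (Ici 0))
    (α : ℝ) : ∃ y c, IsRegularSingularSolution 4 (truncatedRadialForcing h hm) α y c := by
  have hh_abs : Continuous fun s => h |s| := hh.comp_continuous continuous_abs abs_nonneg
  have hzero (s : ℝ) : truncatedRadialForcing h hm s 0 = 0 := by
    simp [truncatedRadialForcing, radialForcing]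
  have hℓ : Continuous fun t => 3 * |h (|t|)| + 12 * |m| * |t| + 6 * |m| ^ 2 * |t| ^ 3 :=
    ((continuous_const.mul hh_abs.abs).add (by fun_prop)).add (by fun_prop)
  refine exists_isRegularSingularSolution four_ne_zero (continuous_truncatedRadialForcing hm hh)
    hℓ (fun s => ?_) (fun s x₁ x₂ => ?_) α
  · rw [hzero, abs_zero]
    positivity
  · simpa only [abs_abs] using abs_truncatedRadialForcing_sub_le hm s x₁ x₂

end RadialForcing

section Confinement

theorem Ici_subset_of_isOpen_of_forall_mem {α : Type*} [ConditionallyCompleteLinearOrder α]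
    [TopologicalSpace α] [OrderTopology α] {s : Set α} {a : α} (hs : IsOpen s) (ha : a ∈ s)
    (h_exit : ∀ b, a < b → Ico a b ⊆ s → b ∈ s) : Ici a ⊆ s := by
  by_contra hsub
  set t : Set α := Ici a ∩ sᶜ
  have ht : t.Nonempty := inter_compl_nonempty_iff.2 hsub
  have ht_bdd : BddBelow t := ⟨a, fun _ hx => hx.1⟩
  obtain ⟨hle, hnotMem⟩ := (isClosed_Ici.inter hs.isClosed_compl).csInf_mem ht ht_bdd
  refine hnotMem (h_exit _ (lt_of_le_of_ne hle fun heq => hnotMem (heq ▸ ha)) fun x hx => ?_)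
  by_contra hxs
  exact (csInf_le ht_bdd ⟨hx.1, hxs⟩).not_gt hx.2

variable {h y c : ℝ → ℝ} {r R : ℝ}

/-- The energy `ẇ² - (w² + 2 w)²` of `w = r² y`, where the dot is the derivative with respect to
`log r` and `c` stands for `y'`. -/
def profileEnergy (y c : ℝ → ℝ) (r : ℝ) : ℝ :=
  (r ^ 2 * (2 * y r + r * c r)) ^ 2 - ((r ^ 2 * y r) ^ 2 + 2 * (r ^ 2 * y r)) ^ 2

theorem hasDerivAt_profileEnergy (hy : HasDerivAt y (c r) r)
    (hc : HasDerivAt (fun r => r * c r) (radialForcing h r (y r, r * c r) - 4 * c r) r) :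
    HasDerivAt (profileEnergy y c) (2 * h r * (r ^ 2 * (2 * y r + r * c r)) ^ 2) r := by
  have hw := (hasDerivAt_pow 2 r).mul hy
  have hw_dot := (hasDerivAt_pow 2 r).mul ((hy.const_mul 2).add hc)
  refine ((hw_dot.pow 2).sub (((hw.pow 2).add (hw.const_mul 2)).pow 2)).congr_deriv ?_
  simp only [Pi.mul_apply, Pi.add_apply, Pi.pow_apply, radialForcing]
  push_cast
  ring

theorem profileEnergy_nonpos (hh : ∀ r ∈ Ioo 0 R, h r ≤ 0) (hy_cont : ContinuousOn y (Icc 0 R))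
    (hc_cont : ContinuousOn c (Icc 0 R)) (hy : ∀ r ∈ Ioo 0 R, HasDerivAt y (c r) r)
    (hc : ∀ r ∈ Ioo 0 R,
      HasDerivAt (fun r => r * c r) (radialForcing h r (y r, r * c r) - 4 * c r) r)
    (hr : r ∈ Icc 0 R) : profileEnergy y c r ≤ 0 := by
  have hanti : AntitoneOn (profileEnergy y c) (Icc 0 R) := by
    refine antitoneOn_of_hasDerivWithinAt_nonpos (convex_Icc 0 R)
      (f' := fun r => 2 * h r * (r ^ 2 * (2 * y r + r * c r)) ^ 2) ?_ ?_ ?_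
    · unfold profileEnergy
      fun_prop
    · rw [interior_Icc]
      exact fun r hr => (hasDerivAt_profileEnergy (hy r hr) (hc r hr)).hasDerivWithinAt
    · rw [interior_Icc]
      exact fun r hr => mul_nonpos_of_nonpos_of_nonneg (by linarith [hh r hr]) (sq_nonneg _)
  calc profileEnergy y c r ≤ profileEnergy y c 0 :=
        hanti ⟨le_rfl, hr.1.trans hr.2⟩ hr hr.1
    _ = 0 := by simp [profileEnergy]

theorem deriv_bounds_of_profileEnergy_nonpos (hE : profileEnergy y c r ≤ 0) (hr : 0 < r)
    (hy_neg : y r < 0) (hy_low : -2 < r ^ 2 * y r) :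
    r * y r ^ 2 ≤ c r ∧ r * c r ≤ -4 * y r := by
  have hw_neg : r ^ 2 * y r < 0 := mul_neg_of_pos_of_neg (by positivity) hy_neg
  have hpot_nonpos : (r ^ 2 * y r) ^ 2 + 2 * (r ^ 2 * y r) ≤ 0 := by nlinarith
  have habs : |r ^ 2 * (2 * y r + r * c r)| ≤ -((r ^ 2 * y r) ^ 2 + 2 * (r ^ 2 * y r)) := by
    rw [← abs_of_nonpos hpot_nonpos]
    exact sq_le_sq.1 (sub_nonpos.1 hE)
  obtain ⟨hge, hle⟩ := abs_le.1 habs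
  constructor
  · refine le_of_mul_le_mul_left ?_ (pow_pos hr 3)
    linarith
  · refine le_of_mul_le_mul_left ?_ (pow_pos hr 2)
    linarith [sq_nonneg (r ^ 2 * y r)]

theorem neg_right_of_mul_deriv_le {k : ℕ} (hR : 0 < R) (hy_cont : ContinuousOn y (Icc 0 R))
    (hy : ∀ r ∈ Ioo 0 R, HasDerivAt y (c r) r) (hy_neg : ∀ r ∈ Ioo 0 R, y r < 0)
    (hle : ∀ r ∈ Ioo 0 R, r * c r ≤ -k * y r) : y R < 0 := by
  have hanti : AntitoneOn (fun r => r ^ k * y r) (Icc 0 R) := by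
    refine antitoneOn_of_hasDerivWithinAt_nonpos (convex_Icc 0 R) (by fun_prop)
      (f' := fun r => k * r ^ (k - 1) * y r + r ^ k * c r) ?_ ?_ <;> rw [interior_Icc]
    · exact fun r hr => ((hasDerivAt_pow k r).fun_mul (hy r hr)).hasDerivWithinAt
    · intro r hr
      refine nonpos_of_mul_nonpos_right (a := r) ?_ hr.1
      have hpow : r * (k * r ^ (k - 1)) = k * r ^ k := by
        rcases k with _ | k
        · simp
        · rw [Nat.add_sub_cancel]; ring
      have hpow_pos := pow_pos hr.1 k
      calc r * (k * r ^ (k - 1) * y r + r ^ k * c r) = r ^ k * (r * c r + k * y r) := by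
            linear_combination y r * hpow
        _ ≤ 0 := mul_nonpos_of_nonneg_of_nonpos hpow_pos.le (by linarith [hle r hr])
  have hhalf : R / 2 ∈ Ioo 0 R := ⟨by linarith, by linarith⟩
  have hle_half : R ^ k * y R ≤ (R / 2) ^ k * y (R / 2) :=
    hanti (Ioo_subset_Icc_self hhalf) (right_mem_Icc.2 hR.le) hhalf.2.le
  have hhalf_neg : (R / 2) ^ k * y (R / 2) < 0 :=
    mul_neg_of_pos_of_neg (pow_pos hhalf.1 k) (hy_neg _ hhalf)
  exact neg_of_mul_neg_right (hle_half.trans_lt hhalf_neg) (pow_pos hR k).le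

theorem neg_two_lt_sq_mul_right_of_mul_sq_le_deriv (hR : 0 ≤ R)
    (hy_cont : ContinuousOn y (Icc 0 R)) (hy : ∀ r ∈ Ioo 0 R, HasDerivAt y (c r) r)
    (hy_neg : ∀ r ∈ Icc 0 R, y r < 0) (hle : ∀ r ∈ Ioo 0 R, r * y r ^ 2 ≤ c r) :
    -2 < R ^ 2 * y R := by
  have hanti : AntitoneOn (fun r => (y r)⁻¹ + r ^ 2 / 2) (Icc 0 R) := by
    refine antitoneOn_of_hasDerivWithinAt_nonpos (convex_Icc 0 R)
      (f' := fun r => -c r / y r ^ 2 + r) ?_ ?_ ?_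
    · exact (hy_cont.inv₀ fun r hr => (hy_neg r hr).ne).add (by fun_prop)
    · rw [interior_Icc]
      refine fun r hr => HasDerivAt.hasDerivWithinAt ?_
      refine (((hy r hr).fun_inv (hy_neg r (Ioo_subset_Icc_self hr)).ne).fun_add
        ((hasDerivAt_pow 2 r).div_const 2)).congr_deriv ?_
      ring
    · rw [interior_Icc]
      intro r hr
      have hsq_pos : 0 < y r ^ 2 := sq_pos_of_neg (hy_neg r (Ioo_subset_Icc_self hr))
      rw [neg_div, neg_add_nonpos_iff, le_div_iff₀ hsq_pos]
      exact hle r hr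
  have hinv_le : (y R)⁻¹ + R ^ 2 / 2 ≤ (y 0)⁻¹ := by
    simpa using hanti (left_mem_Icc.2 hR) (right_mem_Icc.2 hR) hR
  have hinv_neg : (y R)⁻¹ + R ^ 2 / 2 < 0 :=
    hinv_le.trans_lt (inv_lt_zero.2 (hy_neg 0 (left_mem_Icc.2 hR)))
  have hyR_neg := hy_neg R (right_mem_Icc.2 hR)
  have hmul_pos := mul_pos_of_neg_of_neg hyR_neg hinv_neg
  rw [mul_add, mul_inv_cancel₀ hyR_neg.ne] at hmul_pos
  linarith

variable {m α : ℝ} {hm : m ≤ 0}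

theorem IsRegularSingularSolution.continuous {k : ℕ} {F : ℝ → ℝ × ℝ → ℝ}
    (hyc : IsRegularSingularSolution k F α y c) : Continuous y :=
  continuous_iff_continuousAt.2 fun r => (hyc.hasDerivAt r).continuousAt

theorem IsRegularSingularSolution.deriv_bounds
    (hyc : IsRegularSingularSolution 4 (truncatedRadialForcing h hm) α y c)
    (hh : ∀ r, 0 < r → h r ≤ 0) (hy : ∀ r ∈ Ioo 0 R, y r ∈ Ioo m 0 ∧ -2 < r ^ 2 * y r)
    (hr : r ∈ Ioo 0 R) : r * y r ^ 2 ≤ c r ∧ r * c r ≤ -4 * y r := by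
  have hE : profileEnergy y c r ≤ 0 := by
    refine profileEnergy_nonpos (h := h) (fun r hr => hh r hr.1) hyc.continuous.continuousOn
      hyc.continuous_deriv.continuousOn (fun r _ => hyc.hasDerivAt r) (fun r hr => ?_)
      (Ioo_subset_Icc_self hr)
    rw [← truncatedRadialForcing_of_mem hm hr.1.le (Ioo_subset_Icc_self (hy r hr).1)]
    exact hyc.hasDerivAt_mul r
  exact deriv_bounds_of_profileEnergy_nonpos hE hr.1 (hy r hr).1.2 (hy r hr).2

theorem IsRegularSingularSolution.bounds
    (hyc : IsRegularSingularSolution 4 (truncatedRadialForcing h hm) α y c)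
    (hh : ∀ r, 0 < r → h r ≤ 0) (hmα : m < α) (hα : α < 0) (hr : 0 ≤ r) :
    y r ∈ Ioo m 0 ∧ -2 < r ^ 2 * y r := by
  have hy_cont : Continuous y := hyc.continuous
  have hy_deriv (R : ℝ) : ∀ r ∈ Ioo 0 R, HasDerivAt y (c r) r := fun r _ => hyc.hasDerivAt r
  have hopen : IsOpen {r | y r ∈ Ioo m 0 ∧ -2 < r ^ 2 * y r} :=
    (isOpen_Ioo.preimage hy_cont).inter
      (isOpen_lt continuous_const ((continuous_pow 2).mul hy_cont))
  refine Ici_subset_of_isOpen_of_forall_mem hopen (a := 0) (by simp [hyc.map_zero, hmα, hα])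
    (fun R hR hmem => ?_) hr
  replace hmem : ∀ r ∈ Ioo 0 R, y r ∈ Ioo m 0 ∧ -2 < r ^ 2 * y r := fun r hr =>
    hmem (Ioo_subset_Ico_self hr)
  have hderiv : ∀ r ∈ Ioo 0 R, r * y r ^ 2 ≤ c r ∧ r * c r ≤ -4 * y r := fun r hr =>
    hyc.deriv_bounds hh hmem hr
  have hmono : MonotoneOn y (Icc 0 R) :=
    monotoneOn_of_hasDerivWithinAt_nonneg (convex_Icc 0 R) hy_cont.continuousOn
      (fun r _ => (hyc.hasDerivAt r).hasDerivWithinAt) (by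
        rw [interior_Icc]
        exact fun r hr => (mul_nonneg hr.1.le (sq_nonneg _)).trans (hderiv r hr).1)
  have hle (r : ℝ) (hr : r ∈ Icc 0 R) : y r ≤ y R := hmono hr (right_mem_Icc.2 hR.le) hr.2
  have hα_le : α ≤ y R := hyc.map_zero ▸ hle 0 (left_mem_Icc.2 hR.le)
  have hneg : y R < 0 :=
    neg_right_of_mul_deriv_le (k := 4) hR hy_cont.continuousOn (hy_deriv R)
      (fun r hr => (hmem r hr).1.2) fun r hr => by exact_mod_cast (hderiv r hr).2
  exact ⟨⟨hmα.trans_le hα_le, hneg⟩, neg_two_lt_sq_mul_right_of_mul_sq_le_deriv hR.le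
    hy_cont.continuousOn (hy_deriv R) (fun r hr => (hle r hr).trans_lt hneg)
    fun r hr => (hderiv r hr).1⟩

end Confinement

section Existence

variable {h y c : ℝ → ℝ} {m α : ℝ} {hm : m ≤ 0}

theorem contDiff_two_of_hasDerivAt {u u' u'' : ℝ → ℝ} (hu : ∀ r, HasDerivAt u (u' r) r)
    (hu' : ∀ r, HasDerivAt u' (u'' r) r) (hu'' : Continuous u'') : ContDiff ℝ 2 u := by
  have hderiv : deriv u = u' := funext fun r => (hu r).deriv
  have hderiv' : deriv u' = u'' := funext fun r => (hu' r).deriv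
  rw [← one_add_one_eq_two, contDiff_succ_iff_deriv, hderiv, contDiff_one_iff_deriv, hderiv']
  exact ⟨fun r => (hu r).differentiableAt, by simp, fun r => (hu' r).differentiableAt, hu''⟩

namespace IsRegularSingularSolution

theorem hasDerivAt_id_mul {k : ℕ} {F : ℝ → ℝ × ℝ → ℝ} (hyc : IsRegularSingularSolution k F α y c)
    (r : ℝ) : HasDerivAt (fun r => r * y r) (y r + r * c r) r :=
  ((hasDerivAt_id r).fun_mul (hyc.hasDerivAt r)).congr_deriv (by simp)

theorem hasDerivAt_add_mul {k : ℕ} {F : ℝ → ℝ × ℝ → ℝ} (hyc : IsRegularSingularSolution k F α y c)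
    (r : ℝ) :
    HasDerivAt (fun r => y r + r * c r) (c r + (F r (y r, r * c r) - k * c r)) r :=
  (hyc.hasDerivAt r).fun_add (hyc.hasDerivAt_mul r)

theorem hasInitialData_id_mul {k : ℕ} {F : ℝ → ℝ × ℝ → ℝ}
    (hyc : IsRegularSingularSolution k F α y c) : HasInitialData α fun r => r * y r := by
  refine ⟨zero_mul _, ?_⟩
  simpa [hyc.map_zero] using (hyc.hasDerivAt_id_mul 0).hasDerivWithinAt (s := Ici 0)

theorem isRadialSolution_id_mul
    (hyc : IsRegularSingularSolution 4 (truncatedRadialForcing h hm) α y c)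
    (hh : ContinuousOn h (Ici 0)) (hy_mem : ∀ r, 0 ≤ r → y r ∈ Icc m 0) :
    IsRadialSolution 4 h (Ici 0) fun r => r * y r := by
  have hderiv : deriv (fun r => r * y r) = fun r => y r + r * c r :=
    funext fun r => (hyc.hasDerivAt_id_mul r).deriv
  have hc : Continuous c := hyc.continuous_deriv
  have hF : Continuous fun r => truncatedRadialForcing h hm r (y r, r * c r) :=
    (continuous_truncatedRadialForcing hm hh).comp
      (continuous_id.prodMk (hyc.continuous.prodMk (continuous_id.mul hc)))
  refine ⟨(contDiff_two_of_hasDerivAt hyc.hasDerivAt_id_mul hyc.hasDerivAt_add_mul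
    (by fun_prop)).contDiffOn, fun r hr hr_pos => ?_⟩
  have hr_ne : r ≠ 0 := hr_pos.ne'
  rw [radialODEAt_four_iff hr_ne, hderiv, (hyc.hasDerivAt_add_mul r).deriv,
    truncatedRadialForcing_of_mem hm hr (hy_mem r hr), mul_div_cancel_left₀ _ hr_ne,
    add_sub_cancel_left]
  field_simp
  push_cast
  ring

end IsRegularSingularSolution

theorem exists_isRadialSolution_hasInitialData (hh : ContinuousOn h (Ici 0))
    (hh_nonpos : ∀ r, 0 < r → h r ≤ 0) (hα : α < 0) :
    ∃ u : ℝ → ℝ, IsRadialSolution 4 h (Ici 0) u ∧ HasInitialData α u ∧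
      ∀ r, 0 < r → -2 / r < u r ∧ u r < 0 := by
  have hm : 2 * α ≤ 0 := by linarith
  obtain ⟨y, c, hyc⟩ := exists_isRegularSingularSolution_truncatedRadialForcing hm hh α
  have hy (r : ℝ) (hr : 0 ≤ r) : y r ∈ Ioo (2 * α) 0 ∧ -2 < r ^ 2 * y r :=
    hyc.bounds hh_nonpos (by linarith) hα hr
  refine ⟨fun r => r * y r,
    hyc.isRadialSolution_id_mul hh fun r hr => Ioo_subset_Icc_self (hy r hr).1,
    hyc.hasInitialData_id_mul, fun r hr => ?_⟩
  obtain ⟨⟨-, hneg⟩, hlow⟩ := hy r hr.le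
  refine ⟨?_, mul_neg_of_pos_of_neg hr hneg⟩
  rw [div_lt_iff₀ hr]
  linarith

end Existence

section Uniqueness

theorem nonpos_of_deriv_le_mul_of_tendsto_nhdsGT {V V' : ℝ → ℝ} {L a b : ℝ} (hab : a < b)
    (hV : ∀ r ∈ Ioc a b, HasDerivAt V (V' r) r) (hle : ∀ r ∈ Ioc a b, V' r ≤ L * V r)
    (hlim : Tendsto V (𝓝[>] a) (𝓝 0)) : V b ≤ 0 := by
  have hexp (r : ℝ) : HasDerivAt (fun r => Real.exp (-L * r)) (Real.exp (-L * r) * -L) r := by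
    simpa using ((hasDerivAt_id r).const_mul (-L)).exp
  have hanti : AntitoneOn (fun r => Real.exp (-L * r) * V r) (Ioc a b) := by
    refine antitoneOn_of_hasDerivWithinAt_nonpos (convex_Ioc a b)
      (f' := fun r => Real.exp (-L * r) * (V' r - L * V r))
      (fun r hr => ((hexp r).fun_mul (hV r hr)).continuousAt.continuousWithinAt)
      (fun r hr => ?_) fun r hr => ?_
    · refine (((hexp r).fun_mul (hV r (interior_subset hr))).congr_deriv ?_).hasDerivWithinAt
      ring
    · exact mul_nonpos_of_nonneg_of_nonpos (Real.exp_pos _).le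
        (sub_nonpos.2 (hle r (interior_subset hr)))
  have hlim_exp : Tendsto (fun r => Real.exp (-L * r) * V r) (𝓝[>] a) (𝓝 0) := by
    simpa using ((hexp a).continuousAt.tendsto.mono_left nhdsWithin_le_nhds).mul hlim
  have hnonpos : Real.exp (-L * b) * V b ≤ 0 := by
    refine ge_of_tendsto hlim_exp ?_
    filter_upwards [Ioc_mem_nhdsGT hab] with r hr
    exact hanti hr (right_mem_Ioc.2 hab) hr.2
  exact nonpos_of_mul_nonpos_right hnonpos (Real.exp_pos _)

theorem eq_zero_of_singular_system {A B g : ℝ → ℝ} {K k b : ℝ} (hb : 0 < b) (hK : 0 ≤ K)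
    (hk : 0 ≤ k) (hA : ∀ r ∈ Ioc 0 b, HasDerivAt A (g r) r)
    (hB : ∀ r ∈ Ioc 0 b, HasDerivAt B (g r - k * B r / r) r)
    (hg : ∀ r ∈ Ioc 0 b, |g r| ≤ K * (|A r| + |B r|))
    (hA_lim : Tendsto A (𝓝[>] 0) (𝓝 0)) (hB_lim : Tendsto B (𝓝[>] 0) (𝓝 0)) :
    A b = 0 ∧ B b = 0 := by
  have hV : A b ^ 2 + B b ^ 2 ≤ 0 := by
    refine nonpos_of_deriv_le_mul_of_tendsto_nhdsGT (V := fun r => A r ^ 2 + B r ^ 2)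
      (L := 4 * K) hb (fun r hr => ((hA r hr).fun_pow 2).fun_add ((hB r hr).fun_pow 2))
      (fun r hr => ?_) (by simpa using (hA_lim.pow 2).add (hB_lim.pow 2))
    have hsingular : 0 ≤ k * B r ^ 2 / r := by have := hr.1; positivity
    have hforcing : (A r + B r) * g r ≤ 2 * K * (A r ^ 2 + B r ^ 2) := calc
      (A r + B r) * g r ≤ |A r + B r| * |g r| := (le_abs_self _).trans_eq (abs_mul _ _)
      _ ≤ (|A r| + |B r|) * (K * (|A r| + |B r|)) := by
          gcongr
          exacts [abs_add_le _ _, hg r hr]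
      _ = K * (|A r| + |B r|) ^ 2 := by ring
      _ ≤ K * (2 * (|A r| ^ 2 + |B r| ^ 2)) := by
          gcongr
          exact add_sq_le
      _ = 2 * K * (A r ^ 2 + B r ^ 2) := by simp only [sq_abs]; ring
    push_cast
    linear_combination 2 * hforcing + 2 * hsingular
  constructor <;> nlinarith [sq_nonneg (A b), sq_nonneg (B b)]

theorem tendsto_deriv_nhdsGT_of_contDiffOn {u : ℝ → ℝ} {a b α : ℝ} (hab : a < b)
    (hu : ContDiffOn ℝ 1 u (Ico a b)) (hα : HasDerivWithinAt u α (Ici a) a) :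
    Tendsto (deriv u) (𝓝[>] a) (𝓝 α) := by
  have ha : a ∈ Ico a b := left_mem_Ico.2 hab
  have hcont := hu.continuousOn_derivWithin (uniqueDiffOn_Ico a b) le_rfl a ha
  rw [ContinuousWithinAt, (hα.mono Ico_subset_Ici_self).derivWithin
    (uniqueDiffOn_Ico a b a ha)] at hcont
  rw [← nhdsWithin_Ioo_eq_nhdsGT hab]
  refine (hcont.mono_left (nhdsWithin_mono _ Ioo_subset_Ico_self)).congr' ?_
  filter_upwards [self_mem_nhdsWithin] with r hr
  exact derivWithin_of_mem_nhds (Ico_mem_nhds hr.1 hr.2)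

theorem exists_abs_div_le_of_contDiffOn {u : ℝ → ℝ} {b : ℝ} (hu : ContDiffOn ℝ 1 u (Icc 0 b))
    (hu_zero : u 0 = 0) : ∃ M, ∀ r ∈ Ioc 0 b, |u r / r| ≤ M := by
  obtain ⟨M, hM⟩ := hu.exists_lipschitzOnWith one_ne_zero (convex_Icc 0 b) isCompact_Icc
  refine ⟨M, fun r hr => ?_⟩
  have hdist := hM.dist_le_mul r (Ioc_subset_Icc_self hr) 0 (left_mem_Icc.2 (hr.1.le.trans hr.2))
  rw [Real.dist_eq, Real.dist_eq, hu_zero, sub_zero, sub_zero] at hdist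
  rwa [abs_div, div_le_iff₀ (abs_pos.2 hr.1.ne')]

theorem exists_abs_radialForcing_sub_le {h : ℝ → ℝ} {b : ℝ} (hh : ContinuousOn h (Icc 0 b))
    (M : ℝ) : ∃ K, 0 ≤ K ∧ ∀ r ∈ Icc 0 b, ∀ x₁ x₂ : ℝ × ℝ, |x₁.1| ≤ M → |x₂.1| ≤ M →
      |radialForcing h r x₁ - radialForcing h r x₂| ≤ K * ‖x₁ - x₂‖ := by
  obtain ⟨K, hK⟩ := isCompact_Icc.exists_bound_of_continuousOn
    (f := fun r => 3 * |h r| + 12 * M * |r| + 6 * M ^ 2 * |r| ^ 3) (by fun_prop)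
  refine ⟨max K 0, le_max_right K 0, fun r hr x₁ x₂ hx₁ hx₂ => ?_⟩
  refine (abs_radialForcing_sub_le hx₁ hx₂ h r).trans ?_
  gcongr
  exact (le_abs_self _).trans ((hK r hr).trans (le_max_left K 0))

theorem exists_abs_radialForcing_div_sub_le {h u v : ℝ → ℝ} {b : ℝ}
    (hh : ContinuousOn h (Icc 0 b)) (hu : ContDiffOn ℝ 1 u (Icc 0 b)) (hu_zero : u 0 = 0)
    (hv : ContDiffOn ℝ 1 v (Icc 0 b)) (hv_zero : v 0 = 0) :
    ∃ K, 0 ≤ K ∧ ∀ r ∈ Ioc 0 b, ∀ p q, |radialForcing h r (u r / r, p) -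
      radialForcing h r (v r / r, q)| ≤ K * ‖(u r / r - v r / r, p - q)‖ := by
  obtain ⟨M₁, hM₁⟩ := exists_abs_div_le_of_contDiffOn hu hu_zero
  obtain ⟨M₂, hM₂⟩ := exists_abs_div_le_of_contDiffOn hv hv_zero
  obtain ⟨K, hK, hK_lip⟩ := exists_abs_radialForcing_sub_le hh (max M₁ M₂)
  exact ⟨K, hK, fun r hr p q => hK_lip r (Ioc_subset_Icc_self hr) _ _
    ((hM₁ r hr).trans (le_max_left _ _)) ((hM₂ r hr).trans (le_max_right _ _))⟩

theorem norm_prodMk_le_abs_add_abs (d e : ℝ) : ‖(d, e)‖ ≤ |e + 4 * d| + |e| := by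
  refine norm_prod_le_iff.2 ⟨?_, le_add_of_nonneg_left (abs_nonneg _)⟩
  have hsub := abs_sub (e + 4 * d) e
  rw [add_sub_cancel_left, abs_mul, Nat.abs_ofNat] at hsub
  rw [Real.norm_eq_abs]
  linarith [abs_nonneg d]

theorem HasInitialData.tendsto_div {u : ℝ → ℝ} {α : ℝ} (hu : HasInitialData α u) :
    Tendsto (fun r => u r / r) (𝓝[>] 0) (𝓝 α) := by
  have hslope := hu.2.Ioi_of_Ici
  rw [hasDerivWithinAt_iff_tendsto_slope' self_notMem_Ioi] at hslope
  refine hslope.congr fun r => ?_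
  rw [slope_def_field, hu.1, sub_zero, sub_zero]

theorem HasInitialData.eq_of_eqOn {u v : ℝ → ℝ} {α β : ℝ} (hu : HasInitialData α u)
    (hv : HasInitialData β v) (huv : EqOn u v (Ici 0)) : α = β :=
  (uniqueDiffWithinAt_Ici 0).eq_deriv _ hu.2 (hv.2.congr huv (huv self_mem_Ici))

namespace IsRadialSolution

variable {h u v : ℝ → ℝ} {s : Set ℝ} {r R α : ℝ}

theorem mono {n : ℕ} {t : Set ℝ} (hu : IsRadialSolution n h s u) (hts : t ⊆ s) :
    IsRadialSolution n h t u :=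
  ⟨hu.1.mono hts, fun r hr => hu.2 r (hts hr)⟩

theorem hasDerivAt_deriv_add_and_sub (hu : IsRadialSolution 4 h s u) (hs : s ∈ 𝓝 r)
    (hr : 0 < r) :
    HasDerivAt (fun r => deriv u r + 3 * (u r / r))
        (radialForcing h r (u r / r, deriv u r - u r / r)) r ∧
      HasDerivAt (fun r => deriv u r - u r / r)
        (radialForcing h r (u r / r, deriv u r - u r / r) - 4 * (deriv u r - u r / r) / r) r := by
  have hu_diff : ContDiffAt ℝ 2 u r := hu.1.contDiffAt hs
  have hu_deriv : HasDerivAt u (deriv u r) r :=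
    (hu_diff.differentiableAt two_ne_zero).hasDerivAt
  have hu_deriv2 : HasDerivAt (deriv u) (deriv (deriv u) r) r :=
    ((hu_diff.derivWithin (m := 1) one_add_one_eq_two.le).differentiableAt
      one_ne_zero).hasDerivAt
  have hdiv := hu_deriv.fun_div (hasDerivAt_id' r) hr.ne'
  have hode := (radialODEAt_four_iff hr.ne').1 (hu.2 r (mem_of_mem_nhds hs) hr)
  refine ⟨(hu_deriv2.fun_add (hdiv.const_mul 3)).congr_deriv ?_,
    (hu_deriv2.fun_sub hdiv).congr_deriv ?_⟩ <;> rw [hode] <;> field_simp <;> ring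

theorem eqOn_Ico (hh : ContinuousOn h (Ico 0 R)) (hu : IsRadialSolution 4 h (Ico 0 R) u)
    (hu_init : HasInitialData α u) (hv : IsRadialSolution 4 h (Ico 0 R) v)
    (hv_init : HasInitialData α v) : EqOn u v (Ico 0 R) := by
  intro b hb
  rcases hb.1.eq_or_lt with rfl | hb_pos
  · rw [hu_init.1, hv_init.1]
  have hR : 0 < R := hb_pos.trans hb.2
  have hsub : Icc 0 b ⊆ Ico 0 R := Icc_subset_Ico_right hb.2
  have hnhds (r : ℝ) (hr : r ∈ Ioc 0 b) : Ico 0 R ∈ 𝓝 r :=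
    Ico_mem_nhds hr.1 (hr.2.trans_lt hb.2)
  have hu_one : ContDiffOn ℝ 1 u (Ico 0 R) := hu.1.of_le one_le_two
  have hv_one : ContDiffOn ℝ 1 v (Ico 0 R) := hv.1.of_le one_le_two
  obtain ⟨K, hK, hK_lip⟩ := exists_abs_radialForcing_div_sub_le (hh.mono hsub)
    (hu_one.mono hsub) hu_init.1 (hv_one.mono hsub) hv_init.1
  have hdiv_lim := hu_init.tendsto_div.sub hv_init.tendsto_div
  have hderiv_lim := (tendsto_deriv_nhdsGT_of_contDiffOn hR hu_one hu_init.2).sub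
    (tendsto_deriv_nhdsGT_of_contDiffOn hR hv_one hv_init.2)
  let A : ℝ → ℝ := fun r => deriv u r + 3 * (u r / r) - (deriv v r + 3 * (v r / r))
  let B : ℝ → ℝ := fun r => deriv u r - u r / r - (deriv v r - v r / r)
  have hAB : A b = 0 ∧ B b = 0 := by
    refine eq_zero_of_singular_system (k := 4) hb_pos hK four_pos.le
      (fun r hr => (hu.hasDerivAt_deriv_add_and_sub (hnhds r hr) hr.1).1.fun_sub
        (hv.hasDerivAt_deriv_add_and_sub (hnhds r hr) hr.1).1)
      (fun r hr => ((hu.hasDerivAt_deriv_add_and_sub (hnhds r hr) hr.1).2.fun_sub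
        (hv.hasDerivAt_deriv_add_and_sub (hnhds r hr) hr.1).2).congr_deriv (by ring))
      (fun r hr => ?_) ?_ ?_
    · refine (hK_lip r hr _ _).trans ?_
      gcongr
      refine (norm_prodMk_le_abs_add_abs _ _).trans_eq ?_
      simp only [A, B]
      ring_nf
    · simpa [A, add_sub_add_comm, mul_sub] using hderiv_lim.add (hdiv_lim.const_mul 3)
    · simpa [B, sub_sub_sub_comm] using hderiv_lim.sub hdiv_lim
  obtain ⟨hA, hB⟩ := hAB
  refine (div_left_inj' hb_pos.ne').1 ?_
  simp only [A, B] at hA hB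
  linarith

theorem eqOn_Ici (hh : ContinuousOn h (Ici 0)) (hu : IsRadialSolution 4 h (Ici 0) u)
    (hu_init : HasInitialData α u) (hv : IsRadialSolution 4 h (Ici 0) v)
    (hv_init : HasInitialData α v) : EqOn u v (Ici 0) := fun r hr =>
  (hu.mono Ico_subset_Ici_self).eqOn_Ico (hh.mono Ico_subset_Ici_self) hu_init
    (hv.mono Ico_subset_Ici_self) hv_init ⟨hr, lt_add_one r⟩

end IsRadialSolution

end Uniqueness

theorem mainTheorem2 (h : ℝ → ℝ) (h_cont : ContinuousOn h (Set.Ici 0))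
    (h_nonpos : ∀ r : ℝ, 0 < r → h r ≤ 0) :
    (∀ α : ℝ, α < 0 →
      ∃ u : ℝ → ℝ, IsRadialSolution 4 h (Set.Ici 0) u ∧ HasInitialData α u ∧
        (∀ r : ℝ, 0 < r → -2 / r < u r ∧ u r < 0) ∧
        (∀ w : ℝ → ℝ, IsRadialSolution 4 h (Set.Ici 0) w → HasInitialData α w →
          Set.EqOn w u (Set.Ici 0)) ∧
        (∀ R : ℝ, 0 < R → ∀ w : ℝ → ℝ, IsRadialSolution 4 h (Set.Ico 0 R) w →
          HasInitialData α w → Set.EqOn w u (Set.Ico 0 R))) ∧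
    (Set.domRestrict (Set.Ici (0 : ℝ)) ''
      {u : ℝ → ℝ | IsRadialSolution 4 h (Set.Ici 0) u ∧ ∀ r : ℝ, 0 < r → u r < 0}).Infinite := by
  refine ⟨fun α hα => ?_, ?_⟩
  · obtain ⟨u, hu, hu_init, hu_bounds⟩ :=
      exists_isRadialSolution_hasInitialData h_cont h_nonpos hα
    exact ⟨u, hu, hu_init, hu_bounds,
      fun w hw hw_init => hw.eqOn_Ici h_cont hw_init hu hu_init,
      fun R _ w hw hw_init => hw.eqOn_Ico (h_cont.mono Ico_subset_Ici_self) hw_init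
        (hu.mono Ico_subset_Ici_self) hu_init⟩
  · choose! u hu hu_init hu_bounds using fun α (hα : α < 0) =>
      exists_isRadialSolution_hasInitialData h_cont h_nonpos hα
    refine infinite_of_injOn_mapsTo (f := fun α => domRestrict (Ici 0) (u α))
      (fun α hα β hβ heq => ?_)
      (fun α hα => ⟨u α, ⟨hu α hα, fun r hr => (hu_bounds α hα r hr).2⟩, rfl⟩) (Iio_infinite 0)
    exact (hu_init α hα).eq_of_eqOn (hu_init β hβ) fun r hr => congrFun heq ⟨r, hr⟩
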